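/- Let $k$ be an algebraically closed field and let $F$ be a subfield of $k$. Let $S$ be an algebraic semigroup over $k$, that is, a variety over $k$ (a reduced separated scheme of finite type over $k$, not necessarily irreducible or affine) equipped with an associative morphism $\mu : S\times_k S\to S$. Assume that $S$ is defined over $F$: there are a scheme $S_0$ over $F$, an isomorphism $S\cong S_0\times_F k$ over $k$, and an $F$-morphism $\mu_0 : S_0\times_F S_0\to S_0$ whose base change to $k$ is $\mu$. Let $S(F)\subseteq S(k)$ be the semigroup of $F$-points, i.e. of those $k$-points of $S$ that are induced by $F$-points of $S_0$. Then $S(F)$ is strongly $\pi$-regular: for every $x\in S(F)$ there exist an integer $n>0$ and an idempotent $e\in S(F)$ such that $x^n$ belongs to the unit group of the monoid $eS(F)e$ (whose neutral element is $e$). -/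

import Mathlib

open CategoryTheory Limits MonoidalCategory CartesianMonoidalCategory AlgebraicGeometry

universe u

section AbstractSemigroups

/-- The positive powers `x ^ n` of an element of a semigroup:
`x ^ 1 = x` and `x ^ (n + 1) = x ^ n * x`. -/
def semigroupPow {M : Type*} [Semigroup M] (x : M) (n : ℕ+) : M :=
  PNat.recOn n x fun _ y => y * x

/-- For an idempotent `e` of a semigroup `M`, the semigroup `eMe` is a monoid with
neutral element `e`. -/
instance cornerMonoid {M : Type*} [Semigroup M] {e : M} (he : IsIdempotentElem e) :
    Monoid he.Corner where
  __ : Semigroup he.Corner := inferInstanceAs (Semigroup (Subsemigroup.corner e))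
  one := ⟨e, e, by simp_rw [he.eq]⟩
  one_mul r := Subtype.ext ((Subsemigroup.mem_corner_iff he).mp r.2).1
  mul_one r := Subtype.ext ((Subsemigroup.mem_corner_iff he).mp r.2).2

/-- A semigroup `M` is strongly `π`-regular if for every `x` in `M` there are a positive
integer `n` and an idempotent `e` of `M` such that `x ^ n` lies in the unit group of the
monoid `eMe`. -/
def IsStronglyPiRegular (M : Type*) [Semigroup M] : Prop :=
  ∀ x : M, ∃ (n : ℕ+) (e : M) (he : IsIdempotentElem e) (u : he.Cornerˣ),
    (u : he.Corner).1 = semigroupPow x n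

end AbstractSemigroups

noncomputable section

/-- An algebraic semigroup over `k`: a variety over `k` (a reduced, separated scheme of finite
type, not necessarily irreducible, affine or nonempty) with an associative morphism
`S × S ⟶ S`. -/
structure AlgebraicSemigroup (k : Type u) [Field k] where
  /-- the underlying scheme over `k` -/
  X : Over (Spec (CommRingCat.of k))
  reduced : IsReduced X.left
  separated : IsSeparated X.hom
  locallyOfFiniteType : LocallyOfFiniteType X.hom
  quasiCompact : QuasiCompact X.hom
  /-- the multiplication -/
  mul : X ⊗ X ⟶ X
  mul_assoc : mul ▷ X ≫ mul = (α_ X X X).hom ≫ X ◁ mul ≫ mul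

namespace AlgebraicSemigroup

variable {k : Type u} [Field k]

/-- The set `S(k)` of `k`-points of `S`, that is, of sections of `S ⟶ Spec k`. -/
def Points (S : AlgebraicSemigroup k) : Type u :=
  𝟙_ (Over (Spec (CommRingCat.of k))) ⟶ S.X

theorem lift_mul_assoc (S : AlgebraicSemigroup k) {T : Over (Spec (CommRingCat.of k))}
    (x y z : T ⟶ S.X) :
    lift (lift x y ≫ S.mul) z ≫ S.mul = lift x (lift y z ≫ S.mul) ≫ S.mul := by
  have h := congrArg (fun f => lift (lift x y) z ≫ f) S.mul_assoc
  simpa using h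

/-- `S(k)` is a semigroup under the multiplication `(x, y) ↦ μ ∘ (x, y)`. -/
instance (S : AlgebraicSemigroup k) : Semigroup S.Points where
  mul x y := lift x y ≫ S.mul
  mul_assoc x y z :=
    S.lift_mul_assoc x y z

/-- The morphism `Spec k ⟶ Spec F` given by a field extension `k` of `F`. -/
abbrev specMap (F k : Type u) [Field F] [Field k] [Algebra F k] :
    Spec (CommRingCat.of k) ⟶ Spec (CommRingCat.of F) :=
  Spec.map (CommRingCat.ofHom (algebraMap F k))

/-- An `F`-structure on the algebraic semigroup `S` over `k`, for a subfield `F` of `k`: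
a scheme `X₀` over `F` together with an identification of `S` with the base change of `X₀`
to `k`, such that the multiplication of `S` is the base change of an `F`-morphism
`X₀ × X₀ ⟶ X₀`. (Since `S` is separated and of finite type over `k`, so is `X₀` over `F`, and
the multiplication of `X₀` is associative because that of `S` is.) -/
structure FStructure (F : Type u) [Field F] [Algebra F k] (S : AlgebraicSemigroup k) where
  /-- the `F`-form of the underlying variety -/
  X₀ : Over (Spec (CommRingCat.of F))
  /-- the projection of the base change `S = X₀ ×_F k` to `X₀` -/
  proj : S.X.left ⟶ X₀.left
  isPullback : IsPullback proj S.X.hom X₀.hom (specMap F k)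
  /-- the `F`-form of the multiplication -/
  mul₀ : X₀ ⊗ X₀ ⟶ X₀
  mul_proj : S.mul.left ≫ proj =
    pullback.map S.X.hom S.X.hom X₀.hom X₀.hom proj proj (specMap F k)
      isPullback.w.symm isPullback.w.symm ≫ mul₀.left

namespace FStructure

variable {F : Type u} [Field F] [Algebra F k] {S : AlgebraicSemigroup k}

/-- A `k`-point `x` of `S` is an `F`-point (is defined over `F`) if it is the base change of a
section of the `F`-form `X₀ ⟶ Spec F`. -/
def IsRational (A : S.FStructure F) (x : S.Points) : Prop :=
  ∃ x₀ : 𝟙_ (Over (Spec (CommRingCat.of F))) ⟶ A.X₀,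
    Over.Hom.left x ≫ A.proj = specMap F k ≫ x₀.left

theorem lift_mul_proj (A : S.FStructure F)
    {x y : 𝟙_ (Over (Spec (CommRingCat.of k))) ⟶ S.X}
    {x₀ y₀ : 𝟙_ (Over (Spec (CommRingCat.of F))) ⟶ A.X₀}
    (hx : x.left ≫ A.proj = specMap F k ≫ x₀.left)
    (hy : y.left ≫ A.proj = specMap F k ≫ y₀.left) :
    (lift x y ≫ S.mul).left ≫ A.proj = specMap F k ≫ (lift x₀ y₀ ≫ A.mul₀).left := by
  rw [Over.comp_left, Over.comp_left, Category.assoc, A.mul_proj, ← Category.assoc,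
    ← Category.assoc]
  congr 1
  apply pullback.hom_ext
  · rw [Category.assoc, Category.assoc, Over.lift_left, Over.lift_left, pullback.map,
      pullback.lift_fst, pullback.lift_fst, pullback.lift_fst_assoc, hx]
  · rw [Category.assoc, Category.assoc, Over.lift_left, Over.lift_left, pullback.map,
      pullback.lift_snd, pullback.lift_snd, pullback.lift_snd_assoc, hy]

/-- The semigroup `S(F)` of `F`-points of `S`. -/
def rationalPoints (A : S.FStructure F) : Subsemigroup S.Points where
  carrier := {x | A.IsRational x}
  mul_mem' := by
    rintro x y ⟨x₀, hx⟩ ⟨y₀, hy⟩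
    exact ⟨lift x₀ y₀ ≫ A.mul₀, A.lift_mul_proj hx hy⟩

end FStructure

end AlgebraicSemigroup

end

/-! Let `X` be a semigroup scheme of finite type over a field `F` and let `x` be an `F`-point of
`X`. The shear `(y, z) ↦ (y, y * z)` of `X × X` maps `(x ^ i, x ^ j)` to `(x ^ i, x ^ (i + j))`.
As `X` is Noetherian, late powers of `x` are recurrent in the Zariski topology; together with
Chevalley's theorem this puts some `(x ^ i, x ^ j)` with `j < i` in the image of the shear. Hence
`x ^ i` divides `x ^ j` on the left over some extension of `F`, and similarly on the right, so that
over some `T` covering `Spec F` a power of `x` has an inverse in a subgroup of `X(T)`. Such an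
inverse is unique, so it descends to an `F`-point. -/

section Semigroups

variable {M N : Type*} [Semigroup M] [Semigroup N]

theorem semigroupPow_add_one (x : M) (n : ℕ+) :
    semigroupPow x (n + 1) = semigroupPow x n * x :=
  PNat.recOn_succ (p := fun _ => M) n x fun _ y => y * x

theorem semigroupPow_add (x : M) (m n : ℕ+) :
    semigroupPow x (m + n) = semigroupPow x m * semigroupPow x n := by
  induction n using PNat.recOn with
  | one => exact semigroupPow_add_one x m
  | succ n ih => rw [← add_assoc, semigroupPow_add_one, ih, semigroupPow_add_one, mul_assoc]

theorem map_semigroupPow (f : M →ₙ* N) (x : M) (n : ℕ+) :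
    f (semigroupPow x n) = semigroupPow (f x) n := by
  induction n using PNat.recOn with
  | one => rfl
  | succ n ih => rw [semigroupPow_add_one, semigroupPow_add_one, map_mul, ih]

theorem map_rightDvd (f : M →ₙ* N) {x y : M} (h : x ∣ᵣ y) : f x ∣ᵣ f y := by
  obtain ⟨c, rfl⟩ := h
  exact ⟨f c, map_mul f c x⟩

theorem op_semigroupPow (x : M) (n : ℕ+) :
    MulOpposite.op (semigroupPow x n) = semigroupPow (MulOpposite.op x) n := by
  induction n using PNat.recOn with
  | one => rfl
  | succ n ih =>
    rw [add_comm, semigroupPow_add, MulOpposite.op_mul, ih, add_comm, semigroupPow_add_one]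
    rfl

theorem semigroupPow_dvd_semigroupPow (x : M) {m n : ℕ+} (h : m < n) :
    semigroupPow x m ∣ semigroupPow x n :=
  ⟨semigroupPow x (n - m), by rw [← semigroupPow_add, PNat.add_sub_of_lt h]⟩

theorem semigroupPow_dvd_of_dvd {x : M} {i j : ℕ+} (hij : j < i)
    (h : semigroupPow x i ∣ semigroupPow x j) (n : ℕ+) : semigroupPow x n ∣ semigroupPow x j := by
  obtain ⟨d, rfl⟩ : ∃ d, i = d + j := ⟨i - j, by rw [add_comm, PNat.add_sub_of_lt hij]⟩
  have hdvd (m : ℕ+) : semigroupPow x (m * d + j) ∣ semigroupPow x j := by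
    induction m using PNat.recOn with
    | one => rwa [one_mul]
    | succ m ih =>
      rw [add_mul, one_mul, add_assoc, semigroupPow_add]
      refine (mul_dvd_mul_left _ h).trans ?_
      rwa [← semigroupPow_add]
  have hlt : n < n * d + j :=
    (le_mul_of_one_le_right' one_le).trans_lt (PNat.lt_add_right _ _)
  exact (semigroupPow_dvd_semigroupPow x hlt).trans (hdvd n)

/-- `w` is the inverse of `z` in some subgroup of the semigroup `M`; such a `w` is unique. -/
structure IsGroupInverse (z w : M) : Prop where
  comm : z * w = w * z
  mul_mul_self : z * w * z = z
  mul_mul_inverse : w * z * w = w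

namespace IsGroupInverse

theorem unique {z v w : M} (hv : IsGroupInverse z v) (hw : IsGroupInverse z w) : v = w := by
  have h : z * v = z * w :=
    calc z * v = w * z * z * v := by rw [← hw.comm, hw.mul_mul_self]
      _ = w * (z * v * z) := by rw [mul_assoc z v, ← hv.comm]; simp only [mul_assoc]
      _ = z * w := by rw [hv.mul_mul_self, hw.comm]
  calc v = v * (z * w) := by rw [← h, ← mul_assoc, hv.mul_mul_inverse]
    _ = w * z * w := by rw [← mul_assoc, ← hv.comm, h, hw.comm]
    _ = w := hw.mul_mul_inverse

theorem map {z w : M} (h : IsGroupInverse z w) (f : M →ₙ* N) : IsGroupInverse (f z) (f w) where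
  comm := by rw [← map_mul, h.comm, map_mul]
  mul_mul_self := by rw [← map_mul, ← map_mul, h.mul_mul_self]
  mul_mul_inverse := by rw [← map_mul, ← map_mul, h.mul_mul_inverse]

theorem of_map {f : M →ₙ* N} (hf : Function.Injective f) {z w : M}
    (h : IsGroupInverse (f z) (f w)) : IsGroupInverse z w where
  comm := hf (by simp only [map_mul, h.comm])
  mul_mul_self := hf (by simp only [map_mul, h.mul_mul_self])
  mul_mul_inverse := hf (by simp only [map_mul, h.mul_mul_inverse])

theorem of_eq_mul {z r s : M} (hs : z = z * z * s) (hr : z = r * (z * z)) :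
    IsGroupInverse z (r * z * s) := by
  have hsr : z * s = r * z :=
    calc z * s = r * (z * z * s) := by nth_rw 1 [hr]; simp only [mul_assoc]
      _ = r * z := by rw [← hs]
  have hzw : z * (r * z * s) = z * s :=
    calc z * (r * z * s) = z * z * s * s := by rw [← hsr]; simp only [mul_assoc]
      _ = z * s := by rw [← hs]
  have hwz : r * z * s * z = z * s :=
    calc r * z * s * z = r * (z * s) * z := by simp only [mul_assoc]
      _ = r * (r * (z * z)) := by rw [hsr]; simp only [mul_assoc]
      _ = z * s := by rw [← hr, hsr]
  refine ⟨hzw.trans hwz.symm, ?_, ?_⟩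
  · rw [hzw, hsr, mul_assoc, ← hr]
  · calc r * z * s * z * (r * z * s) = r * (z * (r * z * s)) := by
          rw [hwz, hsr]; simp only [mul_assoc]
      _ = r * z * s := by rw [hzw, mul_assoc]

theorem exists_of_sq_dvd {z : M} (h : z * z ∣ z) (h' : z * z ∣ᵣ z) : ∃ w, IsGroupInverse z w := by
  obtain ⟨s, hs⟩ := h
  obtain ⟨r, hr⟩ := h'
  exact ⟨_, of_eq_mul hs hr⟩

theorem exists_semigroupPow_of_dvd {x : M} {i j i' j' : ℕ+} (hij : j < i)
    (h : semigroupPow x i ∣ semigroupPow x j) (hij' : j' < i')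
    (h' : semigroupPow x i' ∣ᵣ semigroupPow x j') : ∃ n w, IsGroupInverse (semigroupPow x n) w := by
  refine ⟨j + j', exists_of_sq_dvd ?_ ?_⟩ <;> rw [← semigroupPow_add]
  · exact (semigroupPow_dvd_of_dvd hij h _).trans
      (semigroupPow_dvd_semigroupPow x (PNat.lt_add_right j j'))
  · simp only [rightDvd_iff_op_dvd_op, op_semigroupPow] at h' ⊢
    exact (semigroupPow_dvd_of_dvd hij' h' _).trans
      (semigroupPow_dvd_semigroupPow _ (PNat.lt_add_left j' j))

end IsGroupInverse

theorem exists_corner_unit_eq_iff {z : M} :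
    (∃ (e : M) (he : IsIdempotentElem e) (u : he.Cornerˣ), (u : he.Corner).1 = z) ↔
      ∃ w, IsGroupInverse z w := by
  constructor
  · rintro ⟨e, he, u, rfl⟩
    have hmul : (u : he.Corner) * (↑u⁻¹ : he.Corner) = 1 := u.mul_inv
    have hmul' : (↑u⁻¹ : he.Corner) * (u : he.Corner) = 1 := u.inv_mul
    exact ⟨(↑u⁻¹ : he.Corner).1, congrArg Subtype.val (hmul.trans hmul'.symm),
      congrArg Subtype.val (by rw [hmul, one_mul] : (u : he.Corner) * ↑u⁻¹ * u = u),
      congrArg Subtype.val (by rw [hmul', one_mul] : (↑u⁻¹ : he.Corner) * u * ↑u⁻¹ = ↑u⁻¹)⟩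
  · rintro ⟨w, h⟩
    have he : IsIdempotentElem (z * w) := by
      rw [IsIdempotentElem, ← mul_assoc, h.mul_mul_self]
    have hz : z ∈ Subsemigroup.corner (z * w) := (Subsemigroup.mem_corner_iff he).mpr
      ⟨h.mul_mul_self, by rw [h.comm, ← mul_assoc, h.mul_mul_self]⟩
    have hw : w ∈ Subsemigroup.corner (z * w) := (Subsemigroup.mem_corner_iff he).mpr
      ⟨by rw [h.comm, h.mul_mul_inverse], by rw [← mul_assoc, h.mul_mul_inverse]⟩
    exact ⟨z * w, he, ⟨⟨z, hz⟩, ⟨w, hw⟩, Subtype.ext rfl, Subtype.ext h.comm.symm⟩, rfl⟩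

theorem isStronglyPiRegular_iff :
    IsStronglyPiRegular M ↔ ∀ x : M, ∃ n w, IsGroupInverse (semigroupPow x n) w :=
  forall_congr' fun _ => exists_congr fun _ => exists_corner_unit_eq_iff

theorem IsStronglyPiRegular.of_surjective (hM : IsStronglyPiRegular M) (f : M →ₙ* N)
    (hf : Function.Surjective f) : IsStronglyPiRegular N := by
  rw [isStronglyPiRegular_iff] at hM ⊢
  intro y
  obtain ⟨x, rfl⟩ := hf y
  obtain ⟨n, w, h⟩ := hM x
  exact ⟨n, f w, map_semigroupPow f x n ▸ h.map f⟩

end Semigroups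

section Recurrence

open Filter TopologicalSpace Topology

theorem eventually_mapClusterPt_self {ι X : Type*} [TopologicalSpace X] [NoetherianSpace X]
    (f : Filter ι) (p : ι → X) : ∀ᶠ i in f, MapClusterPt (p i) f p := by
  have : WellFoundedLT (Closeds X) := ((noetherianSpace_TFAE X).out 0 1).mp ‹_›
  obtain ⟨_, ⟨s, hs, rfl⟩, hmin⟩ := wellFounded_lt.has_min
    ((fun s : Set ι => Closeds.closure (p '' s)) '' f.sets) ⟨_, Set.univ, univ_mem, rfl⟩
  filter_upwards [hs] with i hi
  rw [mapClusterPt_iff_frequently]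
  intro U hU
  rw [frequently_iff]
  intro t ht
  have heq : Closeds.closure (p '' (s ∩ t)) = Closeds.closure (p '' s) :=
    eq_of_le_of_not_lt (Closeds.gc.monotone_l (Set.image_mono Set.inter_subset_left))
      (hmin _ ⟨s ∩ t, inter_mem hs ht, rfl⟩)
  have hmem : p i ∈ closure (p '' (s ∩ t)) := by
    rw [← Closeds.coe_closure, heq]
    exact subset_closure ⟨i, hi, rfl⟩
  obtain ⟨_, hlU, l, hl, rfl⟩ := mem_closure_iff_nhds.mp hmem U hU
  exact ⟨l, hl.2, hlU⟩

variable {P : Type*} [TopologicalSpace P]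

theorem exists_isOpen_inter_subset_or_disjoint {C : Set P} (hC : IsConstructible C) {A : Set P}
    (hA : A.Nonempty) :
    ∃ W, IsOpen W ∧ (W ∩ A).Nonempty ∧ (W ∩ A ⊆ C ∨ Disjoint (W ∩ A) C) := by
  induction hC using IsConstructible.empty_union_induction generalizing A with
  | open_retrocompact U hU _ =>
    by_cases h : (U ∩ A).Nonempty
    · exact ⟨U, hU, h, .inl Set.inter_subset_left⟩
    · refine ⟨Set.univ, isOpen_univ, by rwa [Set.univ_inter], .inr ?_⟩
      rwa [Set.univ_inter, disjoint_comm, Set.disjoint_iff_inter_eq_empty,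
        ← Set.not_nonempty_iff_eq_empty]
  | union s _ t _ ihs iht =>
    obtain ⟨W, hW, hWA, h⟩ := ihs hA
    obtain ⟨W', hW', hWA', h'⟩ := iht hWA
    refine ⟨W' ∩ W, hW'.inter hW, by rwa [Set.inter_assoc], ?_⟩
    rw [Set.inter_assoc]
    rcases h with h | h
    · exact .inl ((Set.inter_subset_right.trans h).trans Set.subset_union_left)
    rcases h' with h' | h'
    · exact .inl (h'.trans Set.subset_union_right)
    · exact .inr ((h.mono_left Set.inter_subset_right).union_right h')
  | compl s _ ih =>
    obtain ⟨W, hW, hWA, h⟩ := ih hA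
    exact ⟨W, hW, hWA, h.symm.imp Set.subset_compl_iff_disjoint_right.mpr
      Set.disjoint_compl_right_iff_subset.mpr⟩

theorem exists_isOpen_inter_subset_of_subset_closure {C Z : Set P} (hC : IsConstructible C)
    (hCZ : C ⊆ Z) (hZC : Z ⊆ closure C) (hZ : Z.Nonempty) :
    ∃ W, IsOpen W ∧ (W ∩ Z).Nonempty ∧ W ∩ Z ⊆ C := by
  obtain ⟨W, hW, ⟨a, haW, haZ⟩, h⟩ := exists_isOpen_inter_subset_or_disjoint hC hZ
  refine ⟨W, hW, ⟨a, haW, haZ⟩, h.resolve_right fun h => ?_⟩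
  obtain ⟨b, hbW, hb⟩ := mem_closure_iff.mp (hZC haZ) W hW haW
  exact h.notMem_of_mem_left ⟨hbW, hCZ hb⟩ hb

section Shear

variable {q : ℕ+ → ℕ+ → P} {n : ℕ+} {φ : P → P}

theorem image2_Ici_subset_closure_image_of_shear
    (hrow : ∀ i ≥ n, ∀ j ≥ n, MapClusterPt (q i j) atTop (q i))
    (hφq : ∀ i j, φ (q i j) = q i (i + j)) :
    Set.image2 q (Set.Ici n) (Set.Ici n) ⊆
      closure (φ '' Set.image2 q (Set.Ici n) (Set.Ici n)) := by
  rintro _ ⟨i, hi, j, hj, rfl⟩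
  refine mem_closure_iff_clusterPt.mpr ((hrow i hi j hj).clusterPt.mono (tendsto_principal.mpr ?_))
  filter_upwards [eventually_ge_atTop (i + n)] with l hl
  have hil : i < l := (PNat.lt_add_right i n).trans_le hl
  have hnl : n ≤ l - i := by rwa [← add_le_add_iff_left i, PNat.add_sub_of_lt hil]
  exact ⟨q i (l - i), ⟨i, hi, l - i, hnl, rfl⟩, by rw [hφq, PNat.add_sub_of_lt hil]⟩

/-- Recurrence along rows makes the pairs `(i, i + j)` dense among all pairs, so the constructible
image of `φ` contains an open part of their closure; recurrence along columns then makes the first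
index exceed the second one. -/
theorem exists_mem_range_of_shear
    (hrow : ∀ i ≥ n, ∀ j ≥ n, MapClusterPt (q i j) atTop (q i))
    (hcol : ∀ i ≥ n, ∀ j ≥ n, MapClusterPt (q i j) atTop (q · j))
    (hφ : Continuous φ) (hφZ : ∀ Z, IsClosed Z → IsConstructible (φ '' Z))
    (hφq : ∀ i j, φ (q i j) = q i (i + j)) :
    ∃ i j, j < i ∧ q i j ∈ Set.range φ := by
  set B : Set P := Set.image2 q (Set.Ici n) (Set.Ici n)
  have hmaps : Set.MapsTo φ B B := by
    rintro _ ⟨i, hi, j, hj, rfl⟩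
    exact ⟨i, hi, i + j, hj.trans (PNat.lt_add_left j i).le, (hφq i j).symm⟩
  have hZC : closure B ⊆ closure (φ '' closure B) :=
    closure_minimal ((image2_Ici_subset_closure_image_of_shear hrow hφq).trans
      (closure_mono (Set.image_mono subset_closure))) isClosed_closure
  have hB : (closure B).Nonempty :=
    ⟨_, subset_closure ⟨n, Set.self_mem_Ici, n, Set.self_mem_Ici, rfl⟩⟩
  obtain ⟨W, hW, ⟨a, haW, haB⟩, hWφ⟩ := exists_isOpen_inter_subset_of_subset_closure
    (hφZ _ isClosed_closure) (hmaps.closure hφ).image_subset hZC hB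
  obtain ⟨_, hijW, i, hi, j, hj, rfl⟩ := mem_closure_iff.mp haB W hW haW
  obtain ⟨l, hlW, hl⟩ := (((hcol i hi j hj).frequently (hW.mem_nhds hijW)).and_eventually
    (eventually_ge_atTop (n + j))).exists
  have hnl : n ≤ l := (PNat.lt_add_right n j).le.trans hl
  have hjl : j < l := (PNat.lt_add_left j n).trans_le hl
  exact ⟨l, j, hjl, Set.image_subset_range _ _ (hWφ ⟨hlW, subset_closure ⟨l, hnl, j, hj, rfl⟩⟩)⟩

end Shear

end Recurrence

section SemigroupObjects

universe v w

/-- A semigroup object of a monoidal category: a monoid object in the sense of `MonObj`, without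
the unit. -/
class SemigroupObj {C : Type w} [Category.{v} C] [MonoidalCategory C] (X : C) where
  mul : X ⊗ X ⟶ X
  mul_assoc : mul ▷ X ≫ mul = (α_ X X X).hom ≫ X ◁ mul ≫ mul

namespace SemigroupObj

/-- A multiplication is a semigroup object structure if it is associative on generalized
elements. -/
abbrev ofLiftAssoc {C : Type w} [Category.{v} C] [CartesianMonoidalCategory C] {X : C}
    (m : X ⊗ X ⟶ X) (h : ∀ {T : C} (x y z : T ⟶ X),
      lift (lift x y ≫ m) z ≫ m = lift x (lift y z ≫ m) ≫ m) : SemigroupObj X where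
  mul := m
  mul_assoc := by
    have hid : lift (lift (fst (X ⊗ X) X ≫ fst X X) (fst (X ⊗ X) X ≫ snd X X)) (snd (X ⊗ X) X) =
        𝟙 ((X ⊗ X) ⊗ X) := by
      rw [← comp_lift, lift_fst_snd, Category.comp_id, lift_fst_snd]
    have h := h (fst (X ⊗ X) X ≫ fst X X) (fst (X ⊗ X) X ≫ snd X X) (snd (X ⊗ X) X)
    rwa [← lift_whiskerRight_assoc, ← lift_whiskerLeft_assoc, ← lift_lift_associator_hom_assoc,
      hid, Category.id_comp, Category.id_comp] at h

variable {C : Type w} [Category.{v} C] [CartesianMonoidalCategory C] (X : C) [SemigroupObj X]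
  {T U : C}

instance : Semigroup (T ⟶ X) where
  mul x y := lift x y ≫ mul
  mul_assoc x y z := by
    have h := congrArg (fun f => lift (lift x y) z ≫ f) (mul_assoc (X := X))
    change lift (lift x y ≫ mul) z ≫ mul = lift x (lift y z ≫ mul) ≫ mul
    simpa using h

variable {X} in
theorem hom_mul_def (x y : T ⟶ X) : x * y = lift x y ≫ mul :=
  rfl

/-- The functoriality in `T` of the semigroup of `T`-points of `X`. -/
def precomp (f : T ⟶ U) : (U ⟶ X) →ₙ* (T ⟶ X) where
  toFun x := f ≫ x
  map_mul' x y := by rw [hom_mul_def, hom_mul_def, ← comp_lift, Category.assoc]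

variable {X}

theorem precomp_apply (f : T ⟶ U) (x : U ⟶ X) : precomp X f x = f ≫ x :=
  rfl

theorem comp_semigroupPow (f : T ⟶ U) (x : U ⟶ X) (n : ℕ+) :
    f ≫ semigroupPow x n = semigroupPow (f ≫ x) n :=
  map_semigroupPow (precomp X f) x n

end SemigroupObj

variable {C : Type w} [Category.{v} C] [CartesianMonoidalCategory C] {X T U : C} [SemigroupObj X]

open SemigroupObj in
theorem IsGroupInverse.exists_of_effectiveEpi {z : U ⟶ X} (π : T ⟶ U) [EffectiveEpi π]
    {w : T ⟶ X} (h : IsGroupInverse (π ≫ z) w) : ∃ w₀, IsGroupInverse z w₀ := by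
  have hw {R : C} (g₁ g₂ : R ⟶ T) (hg : g₁ ≫ π = g₂ ≫ π) : g₁ ≫ w = g₂ ≫ w := by
    have hz : g₁ ≫ π ≫ z = g₂ ≫ π ≫ z := by rw [reassoc_of% hg]
    exact (hz ▸ h.map (precomp X g₁) : IsGroupInverse (g₂ ≫ π ≫ z) _).unique
      (h.map (precomp X g₂))
  refine ⟨EffectiveEpi.desc π w hw, of_map (f := precomp X π) (fun _ _ => (cancel_epi π).mp) ?_⟩
  change IsGroupInverse (π ≫ z) (π ≫ EffectiveEpi.desc π w hw)
  rwa [EffectiveEpi.fac]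

theorem effectiveEpi_of_effectiveEpi_left {C : Type w} [Category.{v} C] {S : C} {T U : Over S}
    (f : T ⟶ U) [EffectiveEpi f.left] : EffectiveEpi f where
  effectiveEpi := ⟨by
    have hcond {V : Over S} (e : T ⟶ V)
        (h : ∀ {Z : Over S} (g₁ g₂ : Z ⟶ T), g₁ ≫ f = g₂ ≫ f → g₁ ≫ e = g₂ ≫ e) {Z : C}
        (g₁ g₂ : Z ⟶ T.left) (hg : g₁ ≫ f.left = g₂ ≫ f.left) : g₁ ≫ e.left = g₂ ≫ e.left := by
      have hT : g₂ ≫ T.hom = g₁ ≫ T.hom := by rw [← Over.w f, reassoc_of% hg]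
      exact congrArg (·.left) (h (Z := Over.mk (g₁ ≫ T.hom)) (Over.homMk g₁) (Over.homMk g₂ hT)
        (Over.OverMorphism.ext hg))
    exact
    { desc e h := Over.homMk (EffectiveEpi.desc f.left e.left (hcond e h)) (by
        rw [← cancel_epi f.left, EffectiveEpi.fac_assoc, Over.w, Over.w])
      fac e h := Over.OverMorphism.ext (EffectiveEpi.fac f.left e.left (hcond e h))
      uniq e h m hm := Over.OverMorphism.ext
        (EffectiveEpi.uniq f.left e.left (hcond e h) m.left (congrArg (·.left) hm)) }⟩

end SemigroupObjects

section TensorProducts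

variable {S : Scheme.{u}} (X Y : Over S)

instance [LocallyOfFiniteType X.hom] [LocallyOfFiniteType Y.hom] :
    LocallyOfFiniteType (X ⊗ Y).hom := by
  rw [Over.tensorObj_hom]; infer_instance

instance [QuasiCompact X.hom] [QuasiCompact Y.hom] : QuasiCompact (X ⊗ Y).hom := by
  rw [Over.tensorObj_hom]; infer_instance

instance [Surjective X.hom] [Surjective Y.hom] : Surjective (X ⊗ Y).hom := by
  rw [Over.tensorObj_hom]; infer_instance

end TensorProducts

section FieldSchemes

variable {F : Type u} [Field F]

theorem effectiveEpi_toUnit (T : Over (Spec (.of F))) [Surjective T.hom] [QuasiCompact T.hom] :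
    EffectiveEpi (toUnit T) := by
  have : EffectiveEpi (toUnit T).left := inferInstanceAs (EffectiveEpi T.hom)
  exact effectiveEpi_of_effectiveEpi_left _

/-- The point of the topological space of `X` underlying an `F`-point. -/
noncomputable def underlyingPoint {X : Over (Spec (.of F))} (x : 𝟙_ (Over (Spec (.of F))) ⟶ X) :
    X.left :=
  x.left (IsLocalRing.closedPoint F)

theorem underlyingPoint_comp {X Y : Over (Spec (.of F))} (x : 𝟙_ (Over (Spec (.of F))) ⟶ X)
    (f : X ⟶ Y) : underlyingPoint (x ≫ f) = f.left (underlyingPoint x) :=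
  Scheme.Hom.comp_apply _ _ _

theorem exists_comp_eq_toUnit_comp {X Y : Over (Spec (.of F))} (f : X ⟶ Y)
    (y : 𝟙_ (Over (Spec (.of F))) ⟶ Y) (h : underlyingPoint y ∈ Set.range f.left) :
    ∃ (T : Over (Spec (.of F))) (t : T ⟶ X),
      Surjective T.hom ∧ QuasiCompact T.hom ∧ t ≫ f = toUnit T ≫ y := by
  obtain ⟨a, ha⟩ := h
  obtain ⟨b, -, -⟩ := Scheme.Pullback.exists_preimage_pullback (f := f.left) (g := y.left) a
    (IsLocalRing.closedPoint F) ha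
  let P : Scheme := pullback f.left y.left
  let ι : Spec (P.residueField b) ⟶ P := P.fromSpecResidueField b
  let s : Spec (P.residueField b) ⟶ Spec (.of F) := ι ≫ pullback.snd f.left y.left
  have hs : (ι ≫ pullback.fst f.left y.left) ≫ X.hom = s := by
    have hy : y.left ≫ Y.hom = 𝟙 _ := Over.w y
    rw [← Over.w f, Category.assoc, pullback.condition_assoc, hy, Category.comp_id]
  refine ⟨Over.mk s, Over.homMk (ι ≫ pullback.fst f.left y.left) hs,
    inferInstanceAs (Surjective s), inferInstanceAs (QuasiCompact s), ?_⟩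
  ext1
  exact (Category.assoc _ _ _).trans ((congrArg (ι ≫ ·) pullback.condition).trans
    (Category.assoc _ _ _).symm)

theorem isNoetherian_of_finiteType (X : Over (Spec (.of F))) [LocallyOfFiniteType X.hom]
    [QuasiCompact X.hom] : IsNoetherian X.left where
  toIsLocallyNoetherian := LocallyOfFiniteType.isLocallyNoetherian X.hom
  toCompactSpace := QuasiCompact.compactSpace_of_compactSpace X.hom

theorem eventually_mapClusterPt_underlyingPoint {ι : Type*} {X : Over (Spec (.of F))}
    [LocallyOfFiniteType X.hom] [QuasiCompact X.hom] (f : Filter ι)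
    (x : ι → (𝟙_ (Over (Spec (.of F))) ⟶ X)) :
    ∀ᶠ i in f, ∀ {Y : Over (Spec (.of F))} (g : X ⟶ Y),
      MapClusterPt (underlyingPoint (x i ≫ g)) f fun j => underlyingPoint (x j ≫ g) := by
  have := isNoetherian_of_finiteType X
  filter_upwards [eventually_mapClusterPt_self f fun i => underlyingPoint (x i)] with i hi Y g
  simp only [underlyingPoint_comp]
  exact hi.continuousAt_comp g.left.continuous.continuousAt

theorem isConstructible_image_left {X Y : Over (Spec (.of F))} [LocallyOfFiniteType X.hom]
    [QuasiCompact X.hom] [LocallyOfFiniteType Y.hom] [QuasiCompact Y.hom] (f : X ⟶ Y)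
    {Z : Set X.left} (hZ : IsClosed Z) : Topology.IsConstructible (f.left '' Z) := by
  have := isNoetherian_of_finiteType X
  have := isNoetherian_of_finiteType Y
  have : LocallyOfFiniteType (f.left ≫ Y.hom) := by rw [Over.w]; infer_instance
  have : LocallyOfFiniteType f.left := locallyOfFiniteType_of_comp f.left Y.hom
  refine f.left.isConstructible_image ?_
  rw [← Topology.isConstructible_compl]
  exact (TopologicalSpace.NoetherianSpace.isCompact _).isConstructible hZ.isOpen_compl

theorem exists_lift_comp_eq {X : Over (Spec (.of F))} [LocallyOfFiniteType X.hom]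
    [QuasiCompact X.hom] (m : X ⊗ X ⟶ X) (x : ℕ+ → (𝟙_ (Over (Spec (.of F))) ⟶ X))
    (hx : ∀ i j, lift (x i) (x j) ≫ m = x (i + j)) :
    ∃ (T : Over (Spec (.of F))) (t : T ⟶ X) (i j : ℕ+), Surjective T.hom ∧ QuasiCompact T.hom ∧
      j < i ∧ lift (toUnit T ≫ x i) t ≫ m = toUnit T ≫ x j := by
  let φ : X ⊗ X ⟶ X ⊗ X := lift (fst X X) m
  obtain ⟨n, hn⟩ := Filter.eventually_atTop.mp
    (eventually_mapClusterPt_underlyingPoint Filter.atTop x)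
  have hrow (i j : ℕ+) (hj : j ≥ n) : MapClusterPt (underlyingPoint (lift (x i) (x j)))
      Filter.atTop fun l => underlyingPoint (lift (x i) (x l)) := by
    simpa [comp_lift] using hn j hj (lift (toUnit X ≫ x i) (𝟙 X))
  have hcol (i : ℕ+) (hi : i ≥ n) (j : ℕ+) : MapClusterPt (underlyingPoint (lift (x i) (x j)))
      Filter.atTop fun l => underlyingPoint (lift (x l) (x j)) := by
    simpa [comp_lift] using hn i hi (lift (𝟙 X) (toUnit X ≫ x j))
  have hφ (i j : ℕ+) : φ.left (underlyingPoint (lift (x i) (x j))) =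
      underlyingPoint (lift (x i) (x (i + j))) := by
    rw [← underlyingPoint_comp, comp_lift, lift_fst, hx]
  obtain ⟨i, j, hij, h⟩ := exists_mem_range_of_shear (fun i _ => hrow i)
    (fun i hi j _ => hcol i hi j) φ.left.continuous (fun _ => isConstructible_image_left φ) hφ
  obtain ⟨T, t, hT, hT', ht⟩ := exists_comp_eq_toUnit_comp φ (lift (x i) (x j)) h
  refine ⟨T, t ≫ snd X X, i, j, hT, hT', hij, ?_⟩
  have hfst : t ≫ fst X X = toUnit T ≫ x i := by simpa [φ] using congrArg (· ≫ fst X X) ht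
  have hsnd : t ≫ m = toUnit T ≫ x j := by simpa [φ] using congrArg (· ≫ snd X X) ht
  have hlift : lift (t ≫ fst X X) (t ≫ snd X X) = t := by
    rw [← comp_lift, lift_fst_snd, Category.comp_id]
  rw [← hfst, hlift, hsnd]

section SemigroupScheme

open SemigroupObj

variable {X : Over (Spec (.of F))} [SemigroupObj X] [LocallyOfFiniteType X.hom]
  [QuasiCompact X.hom]

theorem exists_semigroupPow_dvd (x : 𝟙_ (Over (Spec (.of F))) ⟶ X) :
    ∃ (T : Over (Spec (.of F))) (i j : ℕ+), Surjective T.hom ∧ QuasiCompact T.hom ∧ j < i ∧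
      semigroupPow (toUnit T ≫ x) i ∣ semigroupPow (toUnit T ≫ x) j := by
  obtain ⟨T, t, i, j, hT, hT', hij, ht⟩ :=
    exists_lift_comp_eq mul (semigroupPow x) fun i j => (semigroupPow_add x i j).symm
  refine ⟨T, i, j, hT, hT', hij, t, ?_⟩
  rw [← comp_semigroupPow, ← comp_semigroupPow, ← ht, hom_mul_def]

theorem exists_semigroupPow_rightDvd (x : 𝟙_ (Over (Spec (.of F))) ⟶ X) :
    ∃ (T : Over (Spec (.of F))) (i j : ℕ+), Surjective T.hom ∧ QuasiCompact T.hom ∧ j < i ∧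
      semigroupPow (toUnit T ≫ x) i ∣ᵣ semigroupPow (toUnit T ≫ x) j := by
  obtain ⟨T, t, i, j, hT, hT', hij, ht⟩ :=
    exists_lift_comp_eq (lift (snd X X) (fst X X) ≫ mul) (semigroupPow x) fun i j => by
      rw [comp_lift_assoc, lift_snd, lift_fst, add_comm, semigroupPow_add, hom_mul_def]
  refine ⟨T, i, j, hT, hT', hij, t, ?_⟩
  rw [← comp_semigroupPow, ← comp_semigroupPow, ← ht, hom_mul_def, comp_lift_assoc, lift_snd,
    lift_fst]

end SemigroupScheme

end FieldSchemes

namespace AlgebraicSemigroup.FStructure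

variable {k F : Type u} [Field k] [Field F] [Algebra F k] {S : AlgebraicSemigroup k}
  (A : S.FStructure F)

instance : LocallyOfFiniteType A.X₀.hom :=
  MorphismProperty.of_isPullback_of_descendsAlong (Q := @Surjective ⊓ @Flat ⊓ @QuasiCompact)
    (P := @LocallyOfFiniteType) A.isPullback.flip
    ⟨⟨inferInstance, inferInstance⟩, inferInstance⟩ S.locallyOfFiniteType

instance : QuasiCompact A.X₀.hom := by
  have := S.quasiCompact
  have : Surjective A.proj := MorphismProperty.of_isPullback A.isPullback.flip inferInstance
  have : CompactSpace S.X.left := QuasiCompact.compactSpace_of_compactSpace S.X.hom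
  have : CompactSpace A.X₀.left := A.proj.surjective.compactSpace A.proj.continuous
  infer_instance

variable {T : Over (Spec (.of k))} {T₀ : Over (Spec (.of F))} {f : T.left ⟶ T₀.left}
  (hf : f ≫ T₀.hom = T.hom ≫ specMap F k)

/-- The `T`-point of `S` obtained by base change from a point of the `F`-form of `S`. -/
noncomputable def baseChange (x : T₀ ⟶ A.X₀) : T ⟶ S.X :=
  Over.homMk (A.isPullback.lift (f ≫ x.left) T.hom (by rw [Category.assoc, Over.w, hf]))
    (A.isPullback.lift_snd ..)

theorem baseChange_left_comp_proj (x : T₀ ⟶ A.X₀) :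
    (A.baseChange hf x).left ≫ A.proj = f ≫ x.left :=
  A.isPullback.lift_fst ..

theorem hom_ext {x y : T ⟶ S.X} (h : x.left ≫ A.proj = y.left ≫ A.proj) : x = y :=
  Over.OverMorphism.ext (A.isPullback.hom_ext h ((Over.w x).trans (Over.w y).symm))

theorem baseChange_lift_comp_mul₀ (x y : T₀ ⟶ A.X₀) :
    A.baseChange hf (lift x y ≫ A.mul₀) =
      lift (A.baseChange hf x) (A.baseChange hf y) ≫ S.mul := by
  apply A.hom_ext
  rw [baseChange_left_comp_proj, Over.comp_left, Over.comp_left, Category.assoc, A.mul_proj,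
    ← Category.assoc, ← Category.assoc]
  congr 1
  apply pullback.hom_ext
  · simp only [Category.assoc, Over.lift_left, pullback.map, pullback.lift_fst,
      pullback.lift_fst_assoc, baseChange_left_comp_proj]
  · simp only [Category.assoc, Over.lift_left, pullback.map, pullback.lift_snd,
      pullback.lift_snd_assoc, baseChange_left_comp_proj]

theorem baseChange_injective [Epi f] : Function.Injective (A.baseChange hf) := fun x y h =>
  Over.OverMorphism.ext (by
    rw [← cancel_epi f, ← baseChange_left_comp_proj A hf, h, baseChange_left_comp_proj])

theorem lift_mul₀_assoc {T₀ : Over (Spec (.of F))} (x y z : T₀ ⟶ A.X₀) :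
    lift (lift x y ≫ A.mul₀) z ≫ A.mul₀ = lift x (lift y z ≫ A.mul₀) ≫ A.mul₀ := by
  let T : Over (Spec (.of k)) := Over.mk (pullback.snd T₀.hom (specMap F k))
  let f : T.left ⟶ T₀.left := pullback.fst T₀.hom (specMap F k)
  have hf : f ≫ T₀.hom = T.hom ≫ specMap F k := pullback.condition
  have : Epi f := Flat.epi_of_flat_of_surjective f
  refine A.baseChange_injective hf ?_
  simp only [baseChange_lift_comp_mul₀, S.lift_mul_assoc]

noncomputable instance : SemigroupObj A.X₀ :=
  .ofLiftAssoc A.mul₀ A.lift_mul₀_assoc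

theorem specMap_comp_unit_hom : specMap F k ≫ (𝟙_ (Over (Spec (.of F)))).hom =
    (𝟙_ (Over (Spec (.of k)))).hom ≫ specMap F k :=
  (Category.comp_id _).trans (Category.id_comp _).symm

/-- The homomorphism from the semigroup of sections of the `F`-form of `S` onto `S(F)`. -/
noncomputable def sectionsToRationalPoints :
    (𝟙_ (Over (Spec (.of F))) ⟶ A.X₀) →ₙ* A.rationalPoints where
  toFun x := ⟨A.baseChange specMap_comp_unit_hom x, x,
    A.baseChange_left_comp_proj specMap_comp_unit_hom x⟩
  map_mul' x y := Subtype.ext (A.baseChange_lift_comp_mul₀ specMap_comp_unit_hom x y)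

theorem sectionsToRationalPoints_surjective : Function.Surjective A.sectionsToRationalPoints := by
  rintro ⟨x, x₀, hx⟩
  exact ⟨x₀, Subtype.ext (A.hom_ext
    ((A.baseChange_left_comp_proj specMap_comp_unit_hom x₀).trans hx.symm))⟩

end AlgebraicSemigroup.FStructure

theorem theorem1_general {F : Type u} [Field F] (X : Over (Spec (.of F))) [SemigroupObj X]
    [LocallyOfFiniteType X.hom] [QuasiCompact X.hom] :
    IsStronglyPiRegular (𝟙_ (Over (Spec (.of F))) ⟶ X) := by
  refine isStronglyPiRegular_iff.mpr fun x => ?_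
  obtain ⟨T, i, j, _, _, hij, h⟩ := exists_semigroupPow_dvd x
  obtain ⟨T', i', j', _, _, hij', h'⟩ := exists_semigroupPow_rightDvd x
  have hdvd := map_dvd (SemigroupObj.precomp X (fst T T')) h
  have hdvd' := map_rightDvd (SemigroupObj.precomp X (snd T T')) h'
  rw [map_semigroupPow, map_semigroupPow, SemigroupObj.precomp_apply, comp_toUnit_assoc]
    at hdvd hdvd'
  obtain ⟨n, w, hw⟩ := IsGroupInverse.exists_semigroupPow_of_dvd hij hdvd hij' hdvd'
  have := effectiveEpi_toUnit (T ⊗ T')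
  rw [← SemigroupObj.comp_semigroupPow] at hw
  exact ⟨n, hw.exists_of_effectiveEpi⟩

theorem theorem1 {k : Type u} [Field k] [IsAlgClosed k] {F : Type u} [Field F] [Algebra F k]
    (S : AlgebraicSemigroup k) (A : S.FStructure F) :
    IsStronglyPiRegular A.rationalPoints :=
  (theorem1_general A.X₀).of_surjective A.sectionsToRationalPoints
    A.sectionsToRationalPoints_surjective
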